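/- Let $N\ge 2$ and let $\Omega\subset\mathbb{R}^N$ be a bounded open set with Lipschitz boundary $\Gamma$. Let $H^2_0(\Omega)$ be the closure in $H^2(\Omega)$ of the space of smooth functions with compact support in $\Omega$, let $$\mathscr{H}_{L^2(\Omega)}=\{v\in L^2(\Omega):\ \Delta v=0 \text{ in } \Omega \text{ in the sense of distributions}\},$$ and let $(\mathscr{H}_{L^2(\Omega)})^\perp=\{f\in L^2(\Omega):\ \int_\Omega f\varphi\,dx=0 \text{ for all } \varphi\in\mathscr{H}_{L^2(\Omega)}\}$. Then $$\Delta: H^2_0(\Omega)\longrightarrow(\mathscr{H}_{L^2(\Omega)})^\perp$$ is an isomorphism of Banach spaces, i.e. a linear bijection that is continuous together with its inverse. In particular, for every $f\in L^2(\Omega)$ with $\int_\Omega f\varphi\,dx=0$ for all $\varphi\in\mathscr{H}_{L^2(\Omega)}$ there exists a unique $u\in H^2_0(\Omega)$ with $\Delta u=f$ in $\Omega$, and this $u$ satisfies $u=0$ and $\frac{\partial u}{\partial \mathbf{n}}=0$ on $\Gamma$ in the sense of traces. Here the trace $H^1(\Omega)\to L^2(\Gamma)$ is the extension by continuity of the restriction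 map $\varphi\mapsto\varphi|_\Gamma$ from $\mathscr{D}(\overline\Omega)$, the space of restrictions to $\Omega$ of smooth compactly supported functions on $\mathbb{R}^N$, and $\frac{\partial u}{\partial\mathbf n}=\sum_i (\partial_i u)|_\Gamma\, n_i$, where $\mathbf n$ is the outward unit normal. -/

import Mathlib

open MeasureTheory Filter Topology TopologicalSpace
open scoped ENNReal NNReal Distributions

noncomputable section

namespace DirichletLipschitz

/-- The Euclidean space `ℝ^N`. -/
abbrev Euc (N : ℕ) : Type := EuclideanSpace ℝ (Fin N)

variable {N : ℕ}

/-! ### Domains, boundary measure, normal -/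

/-- `Ω` has Lipschitz boundary: near each boundary point, in a suitable orthonormal frame whose last
vector is `e`, the set `Ω` is the strict epigraph of a Lipschitz function `ψ` of the remaining
variables (a function on the hyperplane orthogonal to `e`). -/
def HasLipschitzBoundary (Ω : Opens (Euc N)) : Prop :=
  ∀ x ∈ frontier (Ω : Set (Euc N)), ∃ e : Euc N, ‖e‖ = 1 ∧
    ∃ (K : ℝ≥0) (ψ : (ℝ ∙ e)ᗮ → ℝ), LipschitzWith K ψ ∧
      ∃ U : Set (Euc N), IsOpen U ∧ x ∈ U ∧
        ∀ y ∈ U, y ∈ Ω ↔ ψ ((ℝ ∙ e)ᗮ.orthogonalProjectionOnto y) < inner ℝ e y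

/-- The surface measure on `Γ = ∂Ω`: the `(N-1)`-dimensional (Euclidean normalized) Hausdorff measure
restricted to the boundary. -/
def surfaceMeasure (Ω : Opens (Euc N)) : Measure (Euc N) :=
  (Measure.euclideanHausdorffMeasure (N - 1)).restrict (frontier (Ω : Set (Euc N)))

/-- `ν` is the outward unit normal to `Ω` at `x`: near `x`, every cone around `-ν` of half-angle less
than a right angle lies in `Ω`, and every such cone around `ν` lies outside `Ω`. There is at most one
such `ν`. -/
def IsOutwardNormal (Ω : Opens (Euc N)) (x ν : Euc N) : Prop :=
  ‖ν‖ = 1 ∧ ∀ ε > 0, ∃ r > 0, ∀ y ∈ Metric.ball x r,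
    (inner ℝ (y - x) ν < -ε * ‖y - x‖ → y ∈ Ω) ∧ (ε * ‖y - x‖ < inner ℝ (y - x) ν → y ∉ Ω)

open Classical in
/-- The outward unit normal field (for a Lipschitz boundary it exists at almost every boundary
point; at the other points the value is `0`). -/
def outwardNormal (Ω : Opens (Euc N)) (x : Euc N) : Euc N :=
  if h : ∃ ν, IsOutwardNormal Ω x ν then h.choose else 0

/-! ### Weak derivatives and Sobolev spaces -/

/-- The Hilbert space `L²(Ω)` of real functions. -/
abbrev L2 (Ω : Opens (Euc N)) : Type :=
  Lp ℝ 2 (volume.restrict (Ω : Set (Euc N)))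

/-- The classical partial derivative `∂ᵢ φ`. -/
def pderiv (i : Fin N) (φ : Euc N → ℝ) (x : Euc N) : ℝ :=
  fderiv ℝ φ x (EuclideanSpace.single i 1)

/-- `v = ∂ᵢ u` in the sense of distributions in `Ω`. -/
def IsWeakDeriv (Ω : Opens (Euc N)) (i : Fin N) (u v : L2 Ω) : Prop :=
  ∀ φ : 𝓓(Ω, ℝ), ∫ x in Ω, u x * pderiv i φ x = -∫ x in Ω, v x * φ x

theorem contDiff_pderiv (i : Fin N) {φ : Euc N → ℝ} (h : ContDiff ℝ (⊤ : ℕ∞) φ) :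
    ContDiff ℝ (⊤ : ℕ∞) (pderiv i φ) :=
  (h.fderiv_right (m := (⊤ : ℕ∞)) (by simp)).clm_apply contDiff_const

theorem hasCompactSupport_pderiv (i : Fin N) {φ : Euc N → ℝ} (h : HasCompactSupport φ) :
    HasCompactSupport (pderiv i φ) :=
  h.fderiv_apply ℝ (EuclideanSpace.single i 1)

theorem integrable_mul_of_compactSupport {Ω : Opens (Euc N)} (u : L2 Ω) {φ : Euc N → ℝ}
    (h : ContDiff ℝ (⊤ : ℕ∞) φ) (h' : HasCompactSupport φ) :
    Integrable (fun x => u x * φ x) (volume.restrict (Ω : Set (Euc N))) :=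
  (Lp.memLp u).integrable_mul
    (h.continuous.memLp_of_hasCompactSupport h' : MemLp φ 2 (volume.restrict (Ω : Set (Euc N))))

theorem integral_add_mul {Ω : Opens (Euc N)} (u v : L2 Ω) {φ : Euc N → ℝ}
    (h : ContDiff ℝ (⊤ : ℕ∞) φ) (h' : HasCompactSupport φ) :
    ∫ x in Ω, (u + v : L2 Ω) x * φ x = (∫ x in Ω, u x * φ x) + ∫ x in Ω, v x * φ x := by
  rw [← integral_add (integrable_mul_of_compactSupport u h h')
    (integrable_mul_of_compactSupport v h h')]
  refine integral_congr_ae ?_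
  filter_upwards [Lp.coeFn_add u v] with x hx
  rw [hx, Pi.add_apply, add_mul]

theorem integral_smul_mul {Ω : Opens (Euc N)} (c : ℝ) (u : L2 Ω) (φ : Euc N → ℝ) :
    ∫ x in Ω, (c • u : L2 Ω) x * φ x = c * ∫ x in Ω, u x * φ x := by
  rw [← integral_const_mul]
  refine integral_congr_ae ?_
  filter_upwards [Lp.coeFn_smul c u] with x hx
  rw [hx, Pi.smul_apply, smul_eq_mul, mul_assoc]

theorem integral_zero_mul {Ω : Opens (Euc N)} (φ : Euc N → ℝ) :
    ∫ x in Ω, (0 : L2 Ω) x * φ x = 0 := by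
  simpa using integral_smul_mul (Ω := Ω) 0 0 φ

theorem isWeakDeriv_zero {Ω : Opens (Euc N)} (i : Fin N) : IsWeakDeriv Ω i 0 0 := by
  intro φ
  rw [integral_zero_mul, integral_zero_mul, neg_zero]

theorem IsWeakDeriv.add {Ω : Opens (Euc N)} {i : Fin N} {u v u' v' : L2 Ω}
    (h : IsWeakDeriv Ω i u v) (h' : IsWeakDeriv Ω i u' v') :
    IsWeakDeriv Ω i (u + u') (v + v') := by
  intro φ
  rw [integral_add_mul _ _ (contDiff_pderiv i φ.contDiff)
    (hasCompactSupport_pderiv i φ.hasCompactSupport),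
    integral_add_mul _ _ φ.contDiff φ.hasCompactSupport, h φ, h' φ]
  ring

theorem IsWeakDeriv.smul {Ω : Opens (Euc N)} {i : Fin N} {u v : L2 Ω}
    (c : ℝ) (h : IsWeakDeriv Ω i u v) : IsWeakDeriv Ω i (c • u) (c • v) := by
  intro φ
  rw [integral_smul_mul, integral_smul_mul, h φ]
  ring

/-- Index set for the derivatives of order at most two: the function itself, its first partial
derivatives, its second partial derivatives. -/
abbrev Jet2 (N : ℕ) : Type := Unit ⊕ (Fin N ⊕ (Fin N × Fin N))

/-- The Sobolev space `H²(Ω)`: functions `u ∈ L²(Ω)` with all weak derivatives up to order two in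
`L²(Ω)`, each `u` being stored together with its (uniquely determined) weak derivatives
`(u, (∂ᵢu)ᵢ, (∂ⱼ∂ᵢu)ᵢⱼ)`. The norm is
`‖u‖² = ‖u‖²_{L²} + ∑ᵢ ‖∂ᵢu‖²_{L²} + ∑ᵢⱼ ‖∂ⱼ∂ᵢu‖²_{L²}`. -/
def H2 (Ω : Opens (Euc N)) : Submodule ℝ (PiLp 2 (fun _ : Jet2 N => L2 Ω)) where
  carrier := {w | (∀ i, IsWeakDeriv Ω i (w (.inl ())) (w (.inr (.inl i)))) ∧
    ∀ i j, IsWeakDeriv Ω j (w (.inr (.inl i))) (w (.inr (.inr (i, j))))}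
  zero_mem' := ⟨fun i => isWeakDeriv_zero i, fun _ j => isWeakDeriv_zero j⟩
  add_mem' := fun ha hb => ⟨fun i => (ha.1 i).add (hb.1 i), fun i j => (ha.2 i j).add (hb.2 i j)⟩
  smul_mem' := fun c _ ha => ⟨fun i => (ha.1 i).smul c, fun i j => (ha.2 i j).smul c⟩

/-- The underlying `L²` function of an element of `H²(Ω)`. -/
def H2val {Ω : Opens (Euc N)} (u : H2 Ω) : L2 Ω := u.1 (.inl ())

/-- The first weak derivative `∂ᵢ u ∈ L²(Ω)` of `u ∈ H²(Ω)`. -/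
def H2deriv {Ω : Opens (Euc N)} (u : H2 Ω) (i : Fin N) : L2 Ω := u.1 (.inr (.inl i))

/-- The Laplacian `Δ : H²(Ω) → L²(Ω)`, `Δu = ∑ᵢ ∂ᵢ∂ᵢu`. -/
def H2laplacian (Ω : Opens (Euc N)) : H2 Ω →L[ℝ] L2 Ω :=
  (∑ i : Fin N, PiLp.proj 2 (𝕜 := ℝ) (fun _ : Jet2 N => L2 Ω) (.inr (.inr (i, i)))) ∘L
    (H2 Ω).subtypeL

/-- The space `𝓓(Ω)` of smooth functions with compact support in `Ω`, as a subspace of `H²(Ω)`. -/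
def testFunctionsH2 (Ω : Opens (Euc N)) : Submodule ℝ (H2 Ω) where
  carrier := {u | ∃ φ : 𝓓(Ω, ℝ), H2val u =ᵐ[volume.restrict (Ω : Set (Euc N))] φ}
  zero_mem' := ⟨0, Lp.coeFn_zero ℝ 2 _⟩
  add_mem' := by
    rintro u v ⟨φ, hφ⟩ ⟨χ, hχ⟩
    exact ⟨φ + χ, (Lp.coeFn_add (H2val u) (H2val v)).trans (hφ.add hχ)⟩
  smul_mem' := by
    rintro c u ⟨φ, hφ⟩
    exact ⟨c • φ, (Lp.coeFn_smul c (H2val u)).trans (hφ.const_smul c)⟩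

/-- The space `H²₀(Ω)`: the closure of `𝓓(Ω)` in `H²(Ω)`. -/
def H20 (Ω : Opens (Euc N)) : Submodule ℝ (H2 Ω) := (testFunctionsH2 Ω).topologicalClosure

/-- The classical Laplacian `∑ᵢ ∂ᵢ∂ᵢφ` of a smooth function. -/
def lap (φ : Euc N → ℝ) (x : Euc N) : ℝ := ∑ i : Fin N, pderiv i (pderiv i φ) x

theorem contDiff_lap {φ : Euc N → ℝ} (h : ContDiff ℝ (⊤ : ℕ∞) φ) :
    ContDiff ℝ (⊤ : ℕ∞) (lap φ) :=
  ContDiff.sum fun i _ => contDiff_pderiv i (contDiff_pderiv i h)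

theorem hasCompactSupport_lap {φ : Euc N → ℝ} (h : HasCompactSupport φ) :
    HasCompactSupport (lap φ) := by
  refine HasCompactSupport.intro (K := tsupport φ) h fun x hx => ?_
  have key : ∀ i, pderiv i (pderiv i φ) x = 0 := fun i => by
    by_contra hne
    refine hx ?_
    have h1 : ∀ g : Euc N → ℝ, tsupport (pderiv i g) ⊆ tsupport g := fun g =>
      tsupport_fderiv_apply_subset ℝ (EuclideanSpace.single i 1)
    exact h1 _ (h1 _ (subset_tsupport _ hne))
  simp [lap, key]

/-- The space of harmonic functions in `L²(Ω)`: those `v ∈ L²(Ω)` with `Δv = 0` in the sense of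
distributions in `Ω`. -/
def harmonicL2 (Ω : Opens (Euc N)) : Submodule ℝ (L2 Ω) where
  carrier := {v | ∀ φ : 𝓓(Ω, ℝ), ∫ x in Ω, v x * lap φ x = 0}
  zero_mem' := fun φ => integral_zero_mul _
  add_mem' := fun {u v} hu hv φ => by
    rw [integral_add_mul u v (contDiff_lap φ.contDiff) (hasCompactSupport_lap φ.hasCompactSupport),
      hu φ, hv φ, add_zero]
  smul_mem' := fun c v hv φ => by rw [integral_smul_mul, hv φ, mul_zero]

/-! ### Traces -/

/-- The functions `φ k ∈ 𝓓(Ω̄)` (restrictions to `Ω` of smooth compactly supported functions on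
`ℝ^N`) converge in `H¹(Ω)` to the function `u` with weak gradient `p`. -/
def TendstoH1 (Ω : Opens (Euc N)) (φ : ℕ → 𝓓((⊤ : Opens (Euc N)), ℝ)) (u : L2 Ω)
    (p : Fin N → L2 Ω) : Prop :=
  Tendsto (fun k => eLpNorm (fun x => φ k x - u x) 2 (volume.restrict (Ω : Set (Euc N))))
      atTop (𝓝 0) ∧
    ∀ i, Tendsto (fun k => eLpNorm (fun x => pderiv i (φ k) x - p i x) 2
      (volume.restrict (Ω : Set (Euc N)))) atTop (𝓝 0)

/-- `u` belongs to `H¹(Ω)` and `g ∈ L²(Γ)` is the trace of `u` on `Γ`, that is, the value at `u` of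
the extension by continuity to `H¹(Ω)` of the restriction map `φ ↦ φ|_Γ` from `𝓓(Ω̄)` to `L²(Γ)`:
`u` is the limit in `H¹(Ω)` of functions in `𝓓(Ω̄)`, and for every such approximating sequence the
restrictions to `Γ` converge to `g` in `L²(Γ)`. -/
def IsTrace (Ω : Opens (Euc N)) (u : L2 Ω) (g : Euc N → ℝ) : Prop :=
  MemLp g 2 (surfaceMeasure Ω) ∧
    ∃ p : Fin N → L2 Ω, (∀ i, IsWeakDeriv Ω i u (p i)) ∧
      (∃ φ, TendstoH1 Ω φ u p) ∧
      ∀ φ, TendstoH1 Ω φ u p →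
        Tendsto (fun k => eLpNorm (fun x => φ k x - g x) 2 (surfaceMeasure Ω)) atTop (𝓝 0)

/-- `h` is the normal derivative `∂u/∂n = ∑ᵢ (∂ᵢu)|_Γ nᵢ` on `Γ` of `u ∈ H²(Ω)`, where `(∂ᵢu)|_Γ` is
the trace of `∂ᵢu`. -/
def IsNormalDeriv (Ω : Opens (Euc N)) (u : H2 Ω) (h : Euc N → ℝ) : Prop :=
  ∃ g : Fin N → Euc N → ℝ, (∀ i, IsTrace Ω (H2deriv u i) (g i)) ∧
    h =ᵐ[surfaceMeasure Ω] fun x => ∑ i, g i x * outwardNormal Ω x i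

end DirichletLipschitz

end

/-!
The Laplacian is an isomorphism from `H²₀(Ω)` onto the orthogonal complement of the harmonic
functions for soft reasons. Integrating by parts twice gives `∑ᵢⱼ ‖∂ⱼ∂ᵢφ‖² = ‖Δφ‖²` for test
functions `φ` (`sum_integral_pderiv_pderiv_sq`), and with Poincaré's inequality
(`integral_sq_le_integral_pderiv_sq`) this becomes the a priori estimate `‖φ‖_{H²} ≤ C ‖Δφ‖_{L²}`,
which extends to `H²₀(Ω)` by density (`exists_norm_le_of_mem_H20`). As `H²(Ω)` is complete
(`isClosed_H2`), the range of `Δ` on `H²₀(Ω)` is closed. A function is orthogonal to this range if and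
only if it is orthogonal to `Δφ` for all test functions `φ`, that is, harmonic in the sense of
distributions (`orthogonal_range_H20laplacian`). Hence the range is the orthogonal complement of the
harmonic functions.

The Lipschitz boundary enters through the trace inequality
`∫_Γ φ² dσ ≤ C ∫_Ω (φ² + |∇φ|²)` for `C¹` functions `φ` (`exists_trace_bound`). Near a boundary point
`Γ` is a piece of a Lipschitz graph, and the Hausdorff measure of a piece of the graph is at most a
constant times the Lebesgue measure of its projection
(`euclideanHausdorffMeasure_restrict_range_le`). A one-dimensional estimate on short vertical segments
starting on `Γ` and contained in `Ω` then reduces the claim to Fubini's theorem.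

For `u ∈ H²₀(Ω)`, both `u` and its derivatives `∂ᵢu` are limits in `H¹(Ω)` of test functions in `Ω`.
By the trace inequality any sequence in `𝓓(Ω̄)` with such a limit differs on `Γ` by `o(1)` in `L²(Γ)`
from a sequence vanishing on `Γ` (`isTrace_zero`), so that all these traces are zero.
-/

noncomputable section

namespace DirichletLipschitz

open Set

variable {N : ℕ} {Ω : Opens (Euc N)}

/-! ### One-dimensional estimate, Hausdorff measure on graphs, Fubini's theorem -/

/-- On an interval of length `δ`, the value of a `C¹` function at the left endpoint is controlled by
its `H¹` norm. -/
theorem ofReal_sq_le_lintegral {g g' : ℝ → ℝ} {δ : ℝ} (hδ : 0 < δ)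
    (hg : ∀ t, HasDerivAt g (g' t) t) (hg' : Continuous g') :
    ENNReal.ofReal (g 0 ^ 2) ≤
      ENNReal.ofReal (1 + δ⁻¹) * ∫⁻ t in Ioo 0 δ, ENNReal.ofReal (g t ^ 2 + g' t ^ 2) := by
  have hgc : Continuous g := continuous_iff_continuousAt.2 fun t => (hg t).continuousAt
  have hc : Continuous fun t => g t ^ 2 + g' t ^ 2 := by fun_prop
  set I : ℝ := ∫ t in 0..δ, (g t ^ 2 + g' t ^ 2) with hI
  -- Integrate `-(g²)' ≤ g² + g'²` from `0` to `t`, and the result over `t ∈ [0, δ]`.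
  have hpt : ∀ t ∈ Icc 0 δ, g 0 ^ 2 ≤ g t ^ 2 + I := by
    intro t ht
    have hftc : ∫ s in 0..t, 2 * g s * g' s = g t ^ 2 - g 0 ^ 2 := by
      refine intervalIntegral.integral_eq_sub_of_hasDerivAt (f := fun s => g s ^ 2) (fun s _ => ?_)
        ((by fun_prop : Continuous fun s => 2 * g s * g' s).intervalIntegrable _ _)
      simpa using (hg s).fun_pow 2
    have h1 : ∫ s in 0..t, -(g s ^ 2 + g' s ^ 2) ≤ ∫ s in 0..t, 2 * g s * g' s :=
      intervalIntegral.integral_mono_on ht.1 (hc.neg.intervalIntegrable _ _)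
        ((by fun_prop : Continuous fun s => 2 * g s * g' s).intervalIntegrable _ _)
        fun s _ => by nlinarith [sq_nonneg (g s + g' s)]
    rw [intervalIntegral.integral_neg] at h1
    have h2 : ∫ s in 0..t, (g s ^ 2 + g' s ^ 2) ≤ I := by
      refine intervalIntegral.integral_mono_interval le_rfl ht.1 ht.2 ?_
        (hc.intervalIntegrable _ _)
      exact Eventually.of_forall fun s => by positivity
    linarith
  have hδI : δ * g 0 ^ 2 ≤ (1 + δ) * I := by
    have h1 : ∫ _ in 0..δ, g 0 ^ 2 ≤ ∫ t in 0..δ, (g t ^ 2 + I) :=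
      intervalIntegral.integral_mono_on hδ.le (by simp)
        ((by fun_prop : Continuous fun t => g t ^ 2 + I).intervalIntegrable _ _) hpt
    have h2 : ∫ t in 0..δ, g t ^ 2 ≤ I :=
      intervalIntegral.integral_mono_on hδ.le
        ((by fun_prop : Continuous fun t => g t ^ 2).intervalIntegrable _ _)
        (hc.intervalIntegrable _ _) fun t _ => by nlinarith [sq_nonneg (g' t)]
    rw [intervalIntegral.integral_add
      ((by fun_prop : Continuous fun t => g t ^ 2).intervalIntegrable _ _) (by simp)] at h1
    simp only [intervalIntegral.integral_const, smul_eq_mul, sub_zero] at h1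
    linarith
  have hle : g 0 ^ 2 ≤ (1 + δ⁻¹) * I := by
    have : (1 + δ⁻¹) * I = ((1 + δ) * I) / δ := by field_simp; ring
    rw [this, le_div_iff₀ hδ]
    linarith
  have hint : ∫⁻ t in Ioo 0 δ, ENNReal.ofReal (g t ^ 2 + g' t ^ 2) = ENNReal.ofReal I := by
    rw [hI, intervalIntegral.integral_of_le hδ.le, integral_Ioc_eq_integral_Ioo,
      ofReal_integral_eq_lintegral_ofReal]
    · exact (hc.integrableOn_Icc (a := 0) (b := δ)).mono_set Ioo_subset_Icc_self
    · exact Eventually.of_forall fun s => by positivity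
  rw [hint, ← ENNReal.ofReal_mul (by positivity)]
  exact ENNReal.ofReal_le_ofReal hle

/-- On the image of a Lipschitz map, the Hausdorff measure is dominated by a multiple of the image of
the Hausdorff measure of the source. -/
theorem euclideanHausdorffMeasure_restrict_range_le {X Y : Type*} [EMetricSpace X]
    [MeasurableSpace X] [BorelSpace X] [EMetricSpace Y] [MeasurableSpace Y] [BorelSpace Y]
    {K : ℝ≥0} {G : X → Y} (hG : LipschitzWith K G) (d : ℕ) {S : Set Y} (hS : S ⊆ range G) :
    (Measure.euclideanHausdorffMeasure d : Measure Y).restrict S ≤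
      ((K : ℝ≥0∞) ^ d) • ((Measure.euclideanHausdorffMeasure d : Measure X).restrict
        (G ⁻¹' S)).map G := by
  refine Measure.le_iff.2 fun s hs => ?_
  rw [Measure.restrict_apply hs, Measure.smul_apply, Measure.map_apply hG.continuous.measurable hs,
    Measure.restrict_apply (hG.continuous.measurable hs), ← preimage_inter,
    ← image_preimage_eq_of_subset (inter_subset_right.trans hS : s ∩ S ⊆ range G)]
  have h := hG.hausdorffMeasure_image_le (d := (d : ℝ)) (by positivity) (G ⁻¹' (s ∩ S))
  rw [preimage_image_preimage]
  simp only [Measure.euclideanHausdorffMeasure_def, Measure.smul_apply, smul_eq_mul,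
    ENNReal.smul_def]
  rw [mul_left_comm]
  gcongr
  simpa using h

/-- Fubini's theorem along the lines parallel to a unit vector `e`. -/
theorem lintegral_eq_lintegral_orthogonal_add_smul {E : Type*} [NormedAddCommGroup E]
    [InnerProductSpace ℝ E] [FiniteDimensional ℝ E] [MeasurableSpace E] [BorelSpace E] {e : E}
    (he : ‖e‖ = 1) {F : E → ℝ≥0∞} (hF : Measurable F) :
    ∫⁻ z, F z = ∫⁻ h : (ℝ ∙ e)ᗮ, ∫⁻ t : ℝ, F (h + t • e) := by
  have h1 : MeasurePreserving (Prod.map (LinearIsometryEquiv.toSpanUnitSingleton (𝕜 := ℝ) e he) id)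
      ((volume : Measure ℝ).prod (volume : Measure (ℝ ∙ e)ᗮ)) volume :=
    (LinearIsometryEquiv.measurePreserving _).prod (MeasurePreserving.id _)
  have h2 := ((LinearIsometryEquiv.measurePreserving (ℝ ∙ e).orthogonalDecomposition.symm).comp
    (WithLp.volume_preserving_toLp (ℝ ∙ e) (ℝ ∙ e)ᗮ)).comp h1
  rw [← h2.lintegral_comp hF, lintegral_prod_symm]
  · refine lintegral_congr fun h => lintegral_congr fun t => ?_
    simp [add_comm]
  · exact (hF.comp h2.measurable).aemeasurable

/-! ### The trace inequality -/

theorem fderiv_apply_eq_sum_pderiv (φ : Euc N → ℝ) (x e : Euc N) :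
    fderiv ℝ φ x e = ∑ i, e i * pderiv i φ x := by
  conv_lhs => rw [← (EuclideanSpace.basisFun (Fin N) ℝ).sum_repr e]
  simp [pderiv]

theorem fderiv_apply_sq_le (φ : Euc N → ℝ) (x : Euc N) {e : Euc N} (he : ‖e‖ = 1) :
    fderiv ℝ φ x e ^ 2 ≤ ∑ i, pderiv i φ x ^ 2 := by
  rw [fderiv_apply_eq_sum_pderiv]
  refine (Finset.sum_mul_sq_le_sq_mul_sq _ _ _).trans_eq ?_
  rw [← EuclideanSpace.real_norm_sq_eq, he]
  simp

/-- In a chart where `Ω` is the strict epigraph of `ψ`, the boundary lies on the graph of `ψ`. -/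
theorem inner_eq_of_mem_frontier {Ω : Opens (Euc N)} {e : Euc N} {ψ : (ℝ ∙ e)ᗮ → ℝ}
    (hψ : Continuous ψ) {U : Set (Euc N)} (hU : IsOpen U)
    (hΩ : ∀ y ∈ U, y ∈ Ω ↔ ψ ((ℝ ∙ e)ᗮ.orthogonalProjectionOnto y) < inner ℝ e y)
    {y : Euc N} (hy : y ∈ frontier (Ω : Set (Euc N))) (hyU : y ∈ U) :
    inner ℝ e y = ψ ((ℝ ∙ e)ᗮ.orthogonalProjectionOnto y) := by
  refine le_antisymm (not_lt.1 fun h => ?_) (not_lt.1 fun h => ?_)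
  · have : y ∈ (Ω : Set (Euc N)) := (hΩ y hyU).2 h
    exact (Ω.isOpen.frontier_eq ▸ hy).2 this
  · have ho : IsOpen (U ∩ {z | inner ℝ e z < ψ ((ℝ ∙ e)ᗮ.orthogonalProjectionOnto z)}) :=
      hU.inter (isOpen_lt (by fun_prop) (by fun_prop))
    obtain ⟨z, ⟨hzU, hz⟩, hzΩ⟩ := mem_closure_iff.1 (frontier_subset_closure hy) _ ho ⟨hyU, h⟩
    exact lt_asymm hz ((hΩ z hzU).1 hzΩ)

/-- The trace inequality near a boundary point: the value of `φ` at a boundary point is controlled by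
`φ` and its derivative on a short vertical segment entering `Ω`, and these segments fill a part of
`Ω` whose volume is comparable to the product of surface measure and length. -/
theorem exists_local_trace_bound (hN : 1 ≤ N) {Ω : Opens (Euc N)} (hLip : HasLipschitzBoundary Ω)
    {x : Euc N} (hx : x ∈ frontier (Ω : Set (Euc N))) :
    ∃ V : Set (Euc N), IsOpen V ∧ x ∈ V ∧ ∃ C : ℝ≥0∞, C ≠ ∞ ∧
      ∀ φ : Euc N → ℝ, ContDiff ℝ 1 φ →
        ∫⁻ y in frontier (Ω : Set (Euc N)) ∩ V, ENNReal.ofReal (φ y ^ 2)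
            ∂(Measure.euclideanHausdorffMeasure (N - 1)) ≤
          C * ∫⁻ y in Ω, ENNReal.ofReal (φ y ^ 2 + ∑ i, pderiv i φ y ^ 2) := by
  obtain ⟨e, he, K, ψ, hψ, U, hU, hxU, hΩ⟩ := hLip x hx
  obtain ⟨r, hr, hrU⟩ := Metric.isOpen_iff.1 hU x hxU
  have hee : inner ℝ e e = (1 : ℝ) := by rw [real_inner_self_eq_norm_sq, he]; norm_num
  have hPe : (ℝ ∙ e)ᗮ.orthogonalProjectionOnto e = 0 :=
    Submodule.orthogonalProjectionOnto_orthogonal_apply_eq_zero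
      (Submodule.mem_span_singleton_self e)
  have heh : ∀ h : (ℝ ∙ e)ᗮ, inner ℝ e (h : Euc N) = 0 := fun h =>
    Submodule.mem_orthogonal_singleton_iff_inner_right.1 h.2
  set Γ := frontier (Ω : Set (Euc N)) with hΓ
  -- `G` parametrizes the graph of `ψ` by the hyperplane orthogonal to `e`.
  set G : (ℝ ∙ e)ᗮ → Euc N := fun h => h + ψ h • e with hGdef
  have hG : LipschitzWith (1 + K) G := by
    refine LipschitzWith.add (LipschitzWith.subtype_val _) (LipschitzWith.of_dist_le_mul ?_)
    intro a b
    rw [dist_eq_norm, ← sub_smul, norm_smul, he, mul_one, ← dist_eq_norm]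
    exact hψ.dist_le_mul a b
  -- For points of `V`, vertical segments of length `r / 2` stay in the chart.
  set V := Metric.ball x (r / 2) with hV
  have hrange : Γ ∩ V ⊆ range G := by
    rintro y ⟨hy, hyV⟩
    refine ⟨(ℝ ∙ e)ᗮ.orthogonalProjectionOnto y, ?_⟩
    have hyU : y ∈ U := hrU (Metric.ball_subset_ball (by linarith) hyV)
    have h := inner_eq_of_mem_frontier hψ.continuous hU hΩ hy hyU
    have h2 := Submodule.starProjection_orthogonal_val (K := ℝ ∙ e) y
    rw [Submodule.starProjection_unit_singleton ℝ he] at h2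
    simp only [hGdef, ← h]
    rw [← Submodule.starProjection_apply, h2, sub_add_cancel]
  set A := G ⁻¹' (Γ ∩ V) with hA
  have hAmeas : MeasurableSet A :=
    hG.continuous.measurable
      (isClosed_frontier.measurableSet.inter Metric.isOpen_ball.measurableSet)
  have hseg : ∀ h ∈ A, ∀ t ∈ Ioo 0 (r / 2), G h + t • e ∈ Ω := by
    rintro h ⟨-, hh⟩ t ht
    refine (hΩ _ (hrU ?_)).2 ?_
    · rw [Metric.mem_ball, dist_eq_norm] at hh ⊢
      calc ‖G h + t • e - x‖ = ‖(G h - x) + t • e‖ := by congr 1; abel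
        _ ≤ ‖G h - x‖ + ‖t • e‖ := norm_add_le _ _
        _ < r / 2 + r / 2 := by
          rw [norm_smul, he, mul_one, Real.norm_of_nonneg ht.1.le]
          exact add_lt_add hh ht.2
        _ = r := by ring
    · simp only [hGdef, map_add, map_smul, hPe, smul_zero, add_zero,
        Submodule.orthogonalProjectionOnto_mem_subspace_eq_self, inner_add_right, inner_smul_right,
        heh, hee]
      linarith [ht.1]
  have hvol : (Measure.euclideanHausdorffMeasure (N - 1) : Measure (ℝ ∙ e)ᗮ) = volume := by
    have : Fact (Module.finrank ℝ (Euc N) = (N - 1) + 1) := ⟨by simp; omega⟩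
    have hf : Module.finrank ℝ (ℝ ∙ e)ᗮ = N - 1 :=
      Submodule.finrank_orthogonal_span_singleton (by rintro rfl; simp at he)
    rw [← hf, InnerProductSpace.euclideanHausdorffMeasure_eq_volume]
  refine ⟨V, Metric.isOpen_ball, Metric.mem_ball_self (by linarith),
    ((1 + K : ℝ≥0) : ℝ≥0∞) ^ (N - 1) * ENNReal.ofReal (1 + (r / 2)⁻¹),
    ENNReal.mul_ne_top (ENNReal.pow_ne_top ENNReal.coe_ne_top) ENNReal.ofReal_ne_top,
    fun φ hφ => ?_⟩
  set F : Euc N → ℝ≥0∞ := fun y => ENNReal.ofReal (φ y ^ 2 + ∑ i, pderiv i φ y ^ 2) with hF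
  have hpc : ∀ v : Euc N, Continuous fun y => fderiv ℝ φ y v := fun v =>
    (hφ.continuous_fderiv one_ne_zero).clm_apply continuous_const
  have hFm : Measurable F := by
    refine (Continuous.measurable ?_).ennreal_ofReal
    exact (hφ.continuous.pow 2).add (continuous_finsetSum _ fun i _ => (hpc _).pow 2)
  have hline : ∀ h, ENNReal.ofReal (φ (G h) ^ 2) ≤
      ENNReal.ofReal (1 + (r / 2)⁻¹) * ∫⁻ t in Ioo 0 (r / 2), F (G h + t • e) := by
    intro h
    have hder : ∀ t : ℝ, HasDerivAt (fun t : ℝ => φ (G h + t • e))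
        (fderiv ℝ φ (G h + t • e) e) t := by
      intro t
      have h1 : HasDerivAt (fun t : ℝ => G h + t • e) e t := by
        simpa using ((hasDerivAt_id t).smul_const e).const_add (G h)
      exact ((hφ.differentiable one_ne_zero) _).hasFDerivAt.comp_hasDerivAt t h1
    have h2 := ofReal_sq_le_lintegral (half_pos hr) hder ((hpc e).comp (by fun_prop))
    simp only [zero_smul, add_zero] at h2
    refine h2.trans ?_
    gcongr with t
    refine ENNReal.ofReal_le_ofReal (add_le_add_right ?_ _)
    exact fderiv_apply_sq_le φ _ he
  calc ∫⁻ y in Γ ∩ V, ENNReal.ofReal (φ y ^ 2) ∂(Measure.euclideanHausdorffMeasure (N - 1))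
      ≤ ∫⁻ y, ENNReal.ofReal (φ y ^ 2) ∂((((1 + K : ℝ≥0) : ℝ≥0∞) ^ (N - 1)) •
          ((Measure.euclideanHausdorffMeasure (N - 1)).restrict A).map G) :=
        lintegral_mono' (euclideanHausdorffMeasure_restrict_range_le hG _ hrange) le_rfl
    _ = ((1 + K : ℝ≥0) : ℝ≥0∞) ^ (N - 1) * ∫⁻ h in A, ENNReal.ofReal (φ (G h) ^ 2) := by
        rw [lintegral_smul_measure, smul_eq_mul, lintegral_map
          (f := fun y => ENNReal.ofReal (φ y ^ 2))
          (hφ.continuous.pow 2).measurable.ennreal_ofReal hG.continuous.measurable, hvol]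
    _ ≤ ((1 + K : ℝ≥0) : ℝ≥0∞) ^ (N - 1) * ∫⁻ h in A, ENNReal.ofReal (1 + (r / 2)⁻¹) *
          ∫⁻ t : ℝ, (Ω : Set (Euc N)).indicator F (G h + t • e) := by
        refine mul_le_mul_right ?_ _
        refine setLIntegral_mono' hAmeas fun h hh => (hline h).trans ?_
        refine mul_le_mul_right ?_ _
        rw [← lintegral_indicator measurableSet_Ioo]
        refine lintegral_mono (indicator_le fun t ht => ?_)
        rw [indicator_of_mem (s := (Ω : Set (Euc N))) (hseg h hh t ht)]
    _ ≤ ((1 + K : ℝ≥0) : ℝ≥0∞) ^ (N - 1) * (ENNReal.ofReal (1 + (r / 2)⁻¹) *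
          ∫⁻ h : (ℝ ∙ e)ᗮ, ∫⁻ t : ℝ, (Ω : Set (Euc N)).indicator F (G h + t • e)) := by
        rw [lintegral_const_mul' _ _ ENNReal.ofReal_ne_top]
        gcongr
        exact Measure.restrict_le_self
    _ = _ := by
        rw [mul_assoc, ← lintegral_indicator Ω.isOpen.measurableSet,
          lintegral_eq_lintegral_orthogonal_add_smul he (hFm.indicator Ω.isOpen.measurableSet)]
        congr 2
        refine lintegral_congr fun h => ?_
        -- The vertical lines are invariant under the shear that straightens the graph.
        conv_rhs => rw [← lintegral_add_left_eq_self _ (ψ h)]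
        simp only [hGdef, add_smul, add_assoc]

/-- The trace inequality on a bounded Lipschitz domain. -/
theorem exists_trace_bound (hN : 1 ≤ N) {Ω : Opens (Euc N)}
    (hbdd : Bornology.IsBounded (Ω : Set (Euc N))) (hLip : HasLipschitzBoundary Ω) :
    ∃ C : ℝ≥0∞, C ≠ ∞ ∧ ∀ φ : Euc N → ℝ, ContDiff ℝ 1 φ →
      ∫⁻ y, ENNReal.ofReal (φ y ^ 2) ∂(surfaceMeasure Ω) ≤
        C * ∫⁻ y in Ω, ENNReal.ofReal (φ y ^ 2 + ∑ i, pderiv i φ y ^ 2) := by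
  have hcomp : IsCompact (frontier (Ω : Set (Euc N))) :=
    Metric.isCompact_of_isClosed_isBounded isClosed_frontier
      (hbdd.closure.subset frontier_subset_closure)
  suffices h : ∃ C : ℝ≥0∞, C ≠ ∞ ∧ ∀ φ : Euc N → ℝ, ContDiff ℝ 1 φ →
      ∫⁻ y in frontier (Ω : Set (Euc N)) ∩ frontier (Ω : Set (Euc N)), ENNReal.ofReal (φ y ^ 2)
          ∂(Measure.euclideanHausdorffMeasure (N - 1)) ≤
        C * ∫⁻ y in Ω, ENNReal.ofReal (φ y ^ 2 + ∑ i, pderiv i φ y ^ 2) by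
    simpa [surfaceMeasure] using h
  refine hcomp.induction_on (p := fun S => ∃ C : ℝ≥0∞, C ≠ ∞ ∧ ∀ φ : Euc N → ℝ, ContDiff ℝ 1 φ →
      ∫⁻ y in frontier (Ω : Set (Euc N)) ∩ S, ENNReal.ofReal (φ y ^ 2)
          ∂(Measure.euclideanHausdorffMeasure (N - 1)) ≤
        C * ∫⁻ y in Ω, ENNReal.ofReal (φ y ^ 2 + ∑ i, pderiv i φ y ^ 2)) ?_ ?_ ?_ ?_
  · exact ⟨0, ENNReal.zero_ne_top, fun φ _ => by simp⟩
  · rintro s t hst ⟨C, hC, h⟩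
    exact ⟨C, hC, fun φ hφ => (lintegral_mono_set (inter_subset_inter_right _ hst)).trans (h φ hφ)⟩
  · rintro s t ⟨C, hC, h⟩ ⟨D, hD, h'⟩
    refine ⟨C + D, ENNReal.add_ne_top.2 ⟨hC, hD⟩, fun φ hφ => ?_⟩
    rw [inter_union_distrib_left, add_mul]
    exact (lintegral_union_le _ _ _).trans (add_le_add (h φ hφ) (h' φ hφ))
  · intro x hx
    obtain ⟨V, hV, hxV, C, hC, h⟩ := exists_local_trace_bound hN hLip hx
    exact ⟨V, mem_nhdsWithin_of_mem_nhds (hV.mem_nhds hxV), C, hC, h⟩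

/-! ### Integration by parts and Poincaré's inequality -/

theorem pderiv_comm {φ : Euc N → ℝ} (h : ContDiff ℝ (⊤ : ℕ∞) φ) (i j : Fin N) :
    pderiv i (pderiv j φ) = pderiv j (pderiv i φ) := by
  have key : ∀ (i j : Fin N) (x : Euc N), pderiv i (pderiv j φ) x =
      fderiv ℝ (fderiv ℝ φ) x (EuclideanSpace.single i 1) (EuclideanSpace.single j 1) := by
    intro i j x
    have hd : DifferentiableAt ℝ (fderiv ℝ φ) x :=
      ((h.fderiv_right (m := 1) (by norm_cast)).differentiable one_ne_zero) x
    change fderiv ℝ (fun y => fderiv ℝ φ y (EuclideanSpace.single j 1)) x _ = _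
    rw [fderiv_clm_apply hd (differentiableAt_const _)]
    simp
  ext x
  rw [key, key]
  exact (h.contDiffAt.isSymmSndFDerivAt
    (by simpa using WithTop.coe_le_coe.2 (le_top : (2 : ℕ∞) ≤ ⊤))).eq _ _

/-- Integration by parts on the whole space against a compactly supported smooth function. -/
theorem integral_mul_pderiv {f g : Euc N → ℝ} (hf : ContDiff ℝ (⊤ : ℕ∞) f)
    (hg : ContDiff ℝ (⊤ : ℕ∞) g) (hg' : HasCompactSupport g) (i : Fin N) :
    ∫ x, f x * pderiv i g x = -∫ x, pderiv i f x * g x := by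
  refine integral_mul_fderiv_eq_neg_fderiv_mul_of_integrable ?_ ?_ ?_
    (fun x _ => hf.differentiable (by simp) x) (fun x _ => hg.differentiable (by simp) x)
  · exact ((contDiff_pderiv i hf).continuous.mul hg.continuous).integrable_of_hasCompactSupport
      hg'.mul_left
  · exact (hf.continuous.mul (contDiff_pderiv i hg).continuous).integrable_of_hasCompactSupport
      (hasCompactSupport_pderiv i hg').mul_left
  · exact (hf.continuous.mul hg.continuous).integrable_of_hasCompactSupport hg'.mul_left

/-- Integrating by parts twice, `∫ (∂ᵢ∂ᵢφ) (∂ⱼ∂ⱼφ) = ∫ (∂ⱼ∂ᵢφ)²`. -/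
theorem integral_pderiv_mul_pderiv {φ : Euc N → ℝ} (h : ContDiff ℝ (⊤ : ℕ∞) φ)
    (h' : HasCompactSupport φ) (i j : Fin N) :
    ∫ x, pderiv i (pderiv i φ) x * pderiv j (pderiv j φ) x =
      ∫ x, pderiv j (pderiv i φ) x ^ 2 := by
  have hi := contDiff_pderiv i h
  have hj := contDiff_pderiv j h
  rw [integral_mul_pderiv (contDiff_pderiv i hi) hj (hasCompactSupport_pderiv j h'),
    pderiv_comm hi j i]
  have := integral_mul_pderiv hj (contDiff_pderiv j hi)
    (hasCompactSupport_pderiv j (hasCompactSupport_pderiv i h')) i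
  simp only [mul_comm (pderiv i (pderiv j (pderiv i φ)) _)]
  rw [this, neg_neg, pderiv_comm h i j]
  simp only [sq]

theorem integrable_mul_of_hasCompactSupport {f g : Euc N → ℝ} (hf : ContDiff ℝ (⊤ : ℕ∞) f)
    (hg : ContDiff ℝ (⊤ : ℕ∞) g) (hg' : HasCompactSupport g) :
    Integrable fun x => f x * g x :=
  (hf.continuous.mul hg.continuous).integrable_of_hasCompactSupport hg'.mul_left

/-- The Laplacian of a compactly supported function controls all its second derivatives. -/
theorem sum_integral_pderiv_pderiv_sq {φ : Euc N → ℝ} (h : ContDiff ℝ (⊤ : ℕ∞) φ)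
    (h' : HasCompactSupport φ) :
    ∑ i, ∑ j, ∫ x, pderiv j (pderiv i φ) x ^ 2 = ∫ x, lap φ x ^ 2 := by
  have hint : ∀ i j, Integrable fun x => pderiv i (pderiv i φ) x * pderiv j (pderiv j φ) x :=
    fun i j => integrable_mul_of_hasCompactSupport (contDiff_pderiv i (contDiff_pderiv i h))
      (contDiff_pderiv j (contDiff_pderiv j h))
      (hasCompactSupport_pderiv j (hasCompactSupport_pderiv j h'))
  simp only [lap, sq (∑ _, _), Finset.sum_mul_sum]
  rw [integral_finsetSum _ fun i _ => integrable_finsetSum _ fun j _ => hint i j]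
  refine Finset.sum_congr rfl fun i _ => ?_
  rw [integral_finsetSum _ fun j _ => hint i j]
  exact Finset.sum_congr rfl fun j _ => (integral_pderiv_mul_pderiv h h' i j).symm

/-- Poincaré's inequality for compactly supported functions on a set of bounded width. -/
theorem integral_sq_le_integral_pderiv_sq {φ : Euc N → ℝ} (h : ContDiff ℝ (⊤ : ℕ∞) φ)
    (h' : HasCompactSupport φ) {R : ℝ} (hR : ∀ x ∈ tsupport φ, ‖x‖ ≤ R) (i : Fin N) :
    ∫ x, φ x ^ 2 ≤ 4 * R ^ 2 * ∫ x, pderiv i φ x ^ 2 := by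
  have hp := contDiff_pderiv i h
  have hp' := hasCompactSupport_pderiv i h'
  have hcoord : ContDiff ℝ (⊤ : ℕ∞) fun x : Euc N => x i :=
    (EuclideanSpace.proj (𝕜 := ℝ) i).contDiff
  have hcoord' : ∀ x, pderiv i (fun x : Euc N => x i) x = 1 := fun x => by
    have : fderiv ℝ (fun x : Euc N => x i) x = EuclideanSpace.proj (𝕜 := ℝ) i :=
      (EuclideanSpace.proj (𝕜 := ℝ) i).fderiv
    simp [pderiv, this]
  have hsq : ∀ x, pderiv i (fun x => φ x ^ 2) x = 2 * φ x * pderiv i φ x := fun x => by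
    simp [pderiv, fderiv_fun_pow 2 (h.differentiable (by simp) x)]
  have hI : Integrable fun x => φ x ^ 2 := by
    simpa only [sq] using integrable_mul_of_hasCompactSupport h h h'
  have hI' : Integrable fun x => pderiv i φ x ^ 2 := by
    simpa only [sq] using integrable_mul_of_hasCompactSupport hp hp hp'
  -- Integrate `φ² = φ² ∂ᵢxᵢ` by parts.
  have hibp := integral_mul_pderiv hcoord (h.pow 2)
    (h'.comp_left (g := fun t : ℝ => t ^ 2) (by simp)) i
  simp only [hcoord', hsq, one_mul] at hibp
  have hle : -∫ x, x i * (2 * φ x * pderiv i φ x) ≤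
      ∫ x, (1 / 2 * φ x ^ 2 + 2 * R ^ 2 * pderiv i φ x ^ 2) := by
    rw [← integral_neg]
    refine integral_mono ?_ ((hI.const_mul _).add (hI'.const_mul _)) fun x => ?_
    · refine Integrable.neg ?_
      refine (integrable_mul_of_hasCompactSupport ((hcoord.mul contDiff_const).mul h) hp
        hp' (f := fun x => x i * 2 * φ x)).congr (Eventually.of_forall fun x => ?_)
      simp only
      ring
    · by_cases hx : x ∈ tsupport φ
      · have h1 : x i ^ 2 ≤ R ^ 2 := by
          rw [← sq_abs]
          have : |x i| ≤ ‖x‖ := PiLp.norm_apply_le x i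
          gcongr
          exact this.trans (hR x hx)
        nlinarith [sq_nonneg (φ x + 2 * x i * pderiv i φ x),
          mul_le_mul_of_nonneg_right h1 (sq_nonneg (pderiv i φ x))]
      · rw [image_eq_zero_of_notMem_tsupport hx]
        have : 0 ≤ 2 * R ^ 2 * pderiv i φ x ^ 2 := by positivity
        simpa using this
  rw [integral_add (hI.const_mul _) (hI'.const_mul _), integral_const_mul, integral_const_mul,
    hibp, neg_neg] at hle
  linarith

/-! ### Test functions in `L²(Ω)` and `H²(Ω)` -/

theorem memLp_two_of_hasCompactSupport {f : Euc N → ℝ} (hf : ContDiff ℝ (⊤ : ℕ∞) f)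
    (hf' : HasCompactSupport f) (μ : Measure (Euc N)) [IsFiniteMeasureOnCompacts μ] :
    MemLp f 2 μ :=
  hf.continuous.memLp_of_hasCompactSupport hf'

theorem setIntegral_mul_eq_inner (u : L2 Ω) {f : Euc N → ℝ}
    (hf : MemLp f 2 (volume.restrict (Ω : Set (Euc N)))) :
    ∫ x in Ω, u x * f x = inner ℝ (hf.toLp f) u := by
  rw [L2.inner_def]
  refine integral_congr_ae ?_
  filter_upwards [hf.coeFn_toLp] with x hx
  simp [hx]

theorem inner_eq_setIntegral_mul (u v : L2 Ω) : inner ℝ u v = ∫ x in Ω, v x * u x := by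
  simp [L2.inner_def]

theorem setIntegral_eq_integral_of_tsupport_subset {f g : Euc N → ℝ}
    (hg : tsupport g ⊆ (Ω : Set (Euc N))) : ∫ x in Ω, f x * g x = ∫ x, f x * g x := by
  refine setIntegral_eq_integral_of_forall_compl_eq_zero fun x hx => ?_
  rw [image_eq_zero_of_notMem_tsupport fun h => hx (hg h), mul_zero]

theorem tsupport_pderiv_subset (i : Fin N) (f : Euc N → ℝ) :
    tsupport (pderiv i f) ⊆ tsupport f :=
  tsupport_fderiv_apply_subset ℝ (EuclideanSpace.single i 1)

/-- The partial derivative of a test function, as a test function. -/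
def pderivTest (i : Fin N) (φ : 𝓓(Ω, ℝ)) : 𝓓(Ω, ℝ) where
  toFun := pderiv i φ
  contDiff' := contDiff_pderiv i φ.contDiff
  hasCompactSupport' := hasCompactSupport_pderiv i φ.hasCompactSupport
  tsupport_subset' := (tsupport_pderiv_subset i φ).trans φ.tsupport_subset

@[simp]
theorem coe_pderivTest (i : Fin N) (φ : 𝓓(Ω, ℝ)) : ⇑(pderivTest i φ) = pderiv i φ := rfl

/-- A test function as an element of `L²(Ω)`. -/
def testToL2 (φ : 𝓓(Ω, ℝ)) : L2 Ω :=
  (memLp_two_of_hasCompactSupport φ.contDiff φ.hasCompactSupport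
    (volume.restrict (Ω : Set (Euc N)))).toLp φ

theorem coeFn_testToL2 (φ : 𝓓(Ω, ℝ)) :
    testToL2 φ =ᵐ[volume.restrict (Ω : Set (Euc N))] φ :=
  MemLp.coeFn_toLp _

theorem norm_sq_eq_integral_of_ae_eq {u : L2 Ω} {f : Euc N → ℝ}
    (hf : tsupport f ⊆ (Ω : Set (Euc N)))
    (h : u =ᵐ[volume.restrict (Ω : Set (Euc N))] f) : ‖u‖ ^ 2 = ∫ x, f x ^ 2 := by
  rw [← real_inner_self_eq_norm_sq, inner_eq_setIntegral_mul]
  simp only [sq]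
  rw [← setIntegral_eq_integral_of_tsupport_subset (f := f) hf]
  refine integral_congr_ae ?_
  filter_upwards [h] with x hx
  rw [hx]

theorem isWeakDeriv_testToL2 (i : Fin N) (φ : 𝓓(Ω, ℝ)) :
    IsWeakDeriv Ω i (testToL2 φ) (testToL2 (pderivTest i φ)) := by
  intro χ
  have h1 : ∫ x in Ω, testToL2 φ x * pderiv i χ x = ∫ x in Ω, φ x * pderiv i χ x :=
    integral_congr_ae ((coeFn_testToL2 φ).mono fun x hx => by simp only [hx])
  have h2 : ∫ x in Ω, testToL2 (pderivTest i φ) x * χ x = ∫ x in Ω, pderiv i φ x * χ x :=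
    integral_congr_ae ((coeFn_testToL2 (pderivTest i φ)).mono fun x hx => by
      simp only [hx, coe_pderivTest])
  rw [h1, h2, setIntegral_eq_integral_of_tsupport_subset
      ((tsupport_pderiv_subset i χ).trans χ.tsupport_subset),
    setIntegral_eq_integral_of_tsupport_subset χ.tsupport_subset,
    integral_mul_pderiv φ.contDiff χ.contDiff χ.hasCompactSupport]

/-- The fundamental lemma of the calculus of variations in `L²(Ω)`. -/
theorem eq_of_forall_setIntegral_mul_eq {u v : L2 Ω}
    (h : ∀ φ : 𝓓(Ω, ℝ), ∫ x in Ω, u x * φ x = ∫ x in Ω, v x * φ x) : u = v := by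
  have key : ∀ᵐ x ∂volume, x ∈ (Ω : Set (Euc N)) → u x - v x = 0 := by
    refine Ω.isOpen.ae_eq_zero_of_integral_contDiff_smul_eq_zero ?_ fun g hg hg' hgΩ => ?_
    · exact locallyIntegrableOn_of_locallyIntegrable_restrict
        (((Lp.memLp u).locallyIntegrable one_le_two).sub
          ((Lp.memLp v).locallyIntegrable one_le_two))
    · have := h ⟨g, hg, hg', hgΩ⟩
      have h3 : ∫ x, g x • (u x - v x) = ∫ x in Ω, (u x * g x - v x * g x) := by
        simp only [← sub_mul]
        rw [setIntegral_eq_integral_of_tsupport_subset (f := fun x => u x - v x) hgΩ]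
        simp only [smul_eq_mul, mul_comm]
      rw [h3, integral_sub (integrable_mul_of_compactSupport u hg hg')
        (integrable_mul_of_compactSupport v hg hg')]
      exact sub_eq_zero.2 this
  refine Lp.ext ?_
  refine (ae_restrict_iff' Ω.isOpen.measurableSet).2 (key.mono fun x hx hxΩ => ?_)
  exact sub_eq_zero.1 (hx hxΩ)

theorem IsWeakDeriv.unique {i : Fin N} {u v v' : L2 Ω} (h : IsWeakDeriv Ω i u v)
    (h' : IsWeakDeriv Ω i u v') : v = v' :=
  eq_of_forall_setIntegral_mul_eq fun φ => neg_injective ((h φ).symm.trans (h' φ))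

/-- A test function with its derivatives, as an element of `H²(Ω)`. -/
def testToH2 (φ : 𝓓(Ω, ℝ)) : H2 Ω :=
  ⟨WithLp.toLp 2 (Sum.elim (fun _ => testToL2 φ) (Sum.elim (fun i => testToL2 (pderivTest i φ))
      fun p => testToL2 (pderivTest p.2 (pderivTest p.1 φ)))),
    fun i => isWeakDeriv_testToL2 i φ, fun i j => isWeakDeriv_testToL2 j (pderivTest i φ)⟩

/-- An element of `H²(Ω)` is determined by the underlying `L²` function. -/
theorem H2val_injective : Function.Injective (H2val : H2 Ω → L2 Ω) := by
  intro u v h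
  have h1 : ∀ i, u.1 (.inr (.inl i)) = v.1 (.inr (.inl i)) := fun i =>
    (u.2.1 i).unique (by rw [show u.1 (.inl ()) = v.1 (.inl ()) from h]; exact v.2.1 i)
  refine Subtype.ext (PiLp.ext ?_)
  rintro (⟨⟩ | i | ⟨i, j⟩)
  · exact h
  · exact h1 i
  · exact (u.2.2 i j).unique (by rw [h1 i]; exact v.2.2 i j)

theorem mem_testFunctionsH2_iff {u : H2 Ω} :
    u ∈ testFunctionsH2 Ω ↔ ∃ φ : 𝓓(Ω, ℝ), u = testToH2 φ := by
  refine ⟨fun ⟨φ, hφ⟩ => ⟨φ, H2val_injective (Lp.ext ?_)⟩, ?_⟩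
  · exact hφ.trans (coeFn_testToL2 φ).symm
  · rintro ⟨φ, rfl⟩
    exact ⟨φ, coeFn_testToL2 φ⟩

/-- Distributional relations pass to `L²` limits, so that `H²(Ω)` is closed in the space of jets. -/
theorem isClosed_H2 : IsClosed (H2 Ω : Set (PiLp 2 (fun _ : Jet2 N => L2 Ω))) := by
  have key : ∀ (i : Fin N) (a b : Jet2 N),
      IsClosed {w : PiLp 2 (fun _ : Jet2 N => L2 Ω) | IsWeakDeriv Ω i (w a) (w b)} := by
    intro i a b
    simp only [IsWeakDeriv, ofPred_forall]
    refine isClosed_iInter fun φ => ?_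
    have h1 := memLp_two_of_hasCompactSupport (contDiff_pderiv i φ.contDiff)
      (hasCompactSupport_pderiv i φ.hasCompactSupport) (volume.restrict (Ω : Set (Euc N)))
    have h2 := memLp_two_of_hasCompactSupport φ.contDiff φ.hasCompactSupport
      (volume.restrict (Ω : Set (Euc N)))
    simp only [setIntegral_mul_eq_inner _ h1, setIntegral_mul_eq_inner _ h2]
    exact isClosed_eq (by fun_prop) (by fun_prop)
  have : (H2 Ω : Set (PiLp 2 (fun _ : Jet2 N => L2 Ω))) =
      (⋂ i, {w | IsWeakDeriv Ω i (w (.inl ())) (w (.inr (.inl i)))}) ∩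
        ⋂ i, ⋂ j, {w | IsWeakDeriv Ω j (w (.inr (.inl i))) (w (.inr (.inr (i, j))))} := by
    ext w
    simp [H2]
  rw [this]
  exact (isClosed_iInter fun i => key i _ _).inter
    (isClosed_iInter fun i => isClosed_iInter fun j => key j _ _)

instance : CompleteSpace (H2 Ω) := isClosed_H2.completeSpace_coe

instance : CompleteSpace (H20 Ω) :=
  (Submodule.isClosed_topologicalClosure (testFunctionsH2 Ω)).completeSpace_coe

theorem H2laplacian_apply (u : H2 Ω) :
    H2laplacian Ω u = ∑ i, u.1 (.inr (.inr (i, i))) := by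
  simp [H2laplacian]

theorem coeFn_H2laplacian_testToH2 (φ : 𝓓(Ω, ℝ)) :
    H2laplacian Ω (testToH2 φ) =ᵐ[volume.restrict (Ω : Set (Euc N))] lap φ := by
  have h : ∀ᵐ x ∂volume.restrict (Ω : Set (Euc N)), ∀ i,
      testToL2 (pderivTest i (pderivTest i φ)) x = pderiv i (pderiv i φ) x :=
    ae_all_iff.2 fun i => coeFn_testToL2 _
  rw [H2laplacian_apply]
  filter_upwards [h, Lp.coeFn_finsetSum Finset.univ
    fun i => testToL2 (pderivTest i (pderivTest i φ))] with x hx hx'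
  refine hx'.trans ?_
  simp [lap, hx]

theorem tsupport_lap_subset (φ : Euc N → ℝ) : tsupport (lap φ) ⊆ tsupport φ := by
  refine closure_minimal (fun x hx => ?_) (isClosed_tsupport φ)
  by_contra hne
  refine hx (Finset.sum_eq_zero fun i _ => ?_)
  exact image_eq_zero_of_notMem_tsupport fun h =>
    hne (tsupport_pderiv_subset i _ (tsupport_pderiv_subset i _ h))

/-! ### The Laplacian on `H²₀(Ω)` -/

/-- The a priori estimate `‖φ‖_{H²} ≤ C ‖Δφ‖_{L²}` for test functions. -/
theorem exists_norm_testToH2_le (hN : 1 ≤ N) (hbdd : Bornology.IsBounded (Ω : Set (Euc N))) :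
    ∃ C : ℝ≥0, ∀ φ : 𝓓(Ω, ℝ), ‖testToH2 φ‖ ≤ C * ‖H2laplacian Ω (testToH2 φ)‖ := by
  obtain ⟨R, hR⟩ := hbdd.exists_norm_le
  -- `D` is the constant of Poincaré's inequality, which is used once for each order.
  set D : ℝ := 4 * R ^ 2 with hD
  have hD0 : 0 ≤ D := by positivity
  refine ⟨Real.toNNReal √(D ^ 2 + D + 1), fun φ => ?_⟩
  rw [Real.coe_toNNReal _ (Real.sqrt_nonneg _)]
  refine le_of_sq_le_sq ?_ (by positivity)
  rw [mul_pow, Real.sq_sqrt (by positivity)]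
  set S := ∫ x, lap φ x ^ 2 with hS
  have hlap : ‖H2laplacian Ω (testToH2 φ)‖ ^ 2 = S :=
    norm_sq_eq_integral_of_ae_eq ((tsupport_lap_subset φ).trans φ.tsupport_subset)
      (coeFn_H2laplacian_testToH2 φ)
  have hnorm : ∀ χ : 𝓓(Ω, ℝ), ‖testToL2 χ‖ ^ 2 = ∫ x, χ x ^ 2 := fun χ =>
    norm_sq_eq_integral_of_ae_eq χ.tsupport_subset (coeFn_testToL2 χ)
  have hP : ∀ (χ : 𝓓(Ω, ℝ)) (i : Fin N),
      ‖testToL2 χ‖ ^ 2 ≤ D * ‖testToL2 (pderivTest i χ)‖ ^ 2 := fun χ i => by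
    rw [hnorm, hnorm]
    exact integral_sq_le_integral_pderiv_sq χ.contDiff χ.hasCompactSupport
      (fun x hx => hR x (χ.tsupport_subset hx)) i
  have hsecond : ∑ i, ∑ j, ‖testToL2 (pderivTest j (pderivTest i φ))‖ ^ 2 = S := by
    simp only [hnorm, coe_pderivTest]
    exact sum_integral_pderiv_pderiv_sq φ.contDiff φ.hasCompactSupport
  have hfirst : ∑ i, ‖testToL2 (pderivTest i φ)‖ ^ 2 ≤ D * S := by
    rw [← hsecond, Finset.mul_sum]
    refine Finset.sum_le_sum fun i _ => (hP _ i).trans ?_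
    gcongr
    exact Finset.single_le_sum
      (f := fun j => ‖testToL2 (pderivTest j (pderivTest i φ))‖ ^ 2)
      (fun _ _ => by positivity) (Finset.mem_univ i)
  have hzero : ‖testToL2 φ‖ ^ 2 ≤ D * (D * S) := by
    refine (hP φ ⟨0, hN⟩).trans ?_
    gcongr
    exact (Finset.single_le_sum (f := fun i => ‖testToL2 (pderivTest i φ)‖ ^ 2)
      (fun _ _ => by positivity) (Finset.mem_univ _)).trans hfirst
  have htot : ‖testToH2 φ‖ ^ 2 = ‖testToL2 φ‖ ^ 2 + (∑ i, ‖testToL2 (pderivTest i φ)‖ ^ 2 +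
      ∑ i, ∑ j, ‖testToL2 (pderivTest j (pderivTest i φ))‖ ^ 2) := by
    rw [show ‖testToH2 φ‖ = ‖(testToH2 φ).1‖ from rfl, PiLp.norm_sq_eq_of_L2]
    simp [testToH2, Fintype.sum_prod_type]
  rw [htot, hlap, hsecond]
  linarith

/-- The a priori estimate extends from test functions to `H²₀(Ω)` by density. -/
theorem exists_norm_le_of_mem_H20 (hN : 1 ≤ N) (hbdd : Bornology.IsBounded (Ω : Set (Euc N))) :
    ∃ C : ℝ≥0, ∀ u ∈ H20 Ω, ‖u‖ ≤ C * ‖H2laplacian Ω u‖ := by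
  obtain ⟨C, hC⟩ := exists_norm_testToH2_le hN hbdd
  refine ⟨C, fun u hu => ?_⟩
  have hcl : IsClosed {u : H2 Ω | ‖u‖ ≤ C * ‖H2laplacian Ω u‖} :=
    isClosed_le (by fun_prop) (by fun_prop)
  refine closure_minimal (fun v hv => ?_) hcl hu
  obtain ⟨φ, rfl⟩ := mem_testFunctionsH2_iff.1 hv
  exact hC φ

/-- The Laplacian on `H²₀(Ω)`. -/
def H20laplacian (Ω : Opens (Euc N)) : H20 Ω →L[ℝ] L2 Ω := H2laplacian Ω ∘L (H20 Ω).subtypeL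

/-- By the very definition of a distributional Laplacian, the harmonic functions are the orthogonal
complement of the range of the Laplacian on `H²₀(Ω)`. -/
theorem orthogonal_range_H20laplacian :
    (H20laplacian Ω).rangeᗮ = harmonicL2 Ω := by
  have key : ∀ (v : L2 Ω) (φ : 𝓓(Ω, ℝ)),
      inner ℝ (H2laplacian Ω (testToH2 φ)) v = ∫ x in Ω, v x * lap φ x := fun v φ => by
    rw [inner_eq_setIntegral_mul]
    exact integral_congr_ae ((coeFn_H2laplacian_testToH2 φ).mono fun x hx => by simp only [hx])
  ext v
  rw [Submodule.mem_orthogonal]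
  refine ⟨fun h φ => ?_, fun h w hw => ?_⟩
  · rw [← key]
    exact h _ ⟨⟨testToH2 φ, subset_closure (mem_testFunctionsH2_iff.2 ⟨φ, rfl⟩)⟩, rfl⟩
  · obtain ⟨⟨u, hu⟩, rfl⟩ := hw
    have hcl : IsClosed {u : H2 Ω | inner ℝ (H2laplacian Ω u) v = 0} :=
      isClosed_eq (by fun_prop) continuous_const
    refine closure_minimal (fun w hw => ?_) hcl hu
    obtain ⟨φ, rfl⟩ := mem_testFunctionsH2_iff.1 hw
    exact (key v φ).trans (h φ)

theorem antilipschitzWith_H20laplacian (hN : 1 ≤ N)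
    (hbdd : Bornology.IsBounded (Ω : Set (Euc N))) :
    ∃ C : ℝ≥0, AntilipschitzWith C (H20laplacian Ω) := by
  obtain ⟨C, hC⟩ := exists_norm_le_of_mem_H20 hN hbdd
  exact ⟨C, (H20laplacian Ω).antilipschitz_of_bound fun u => hC u u.2⟩

/-- The a priori estimate makes the range of the Laplacian closed, so it is its own double orthogonal
complement. -/
theorem range_H20laplacian (hN : 1 ≤ N) (hbdd : Bornology.IsBounded (Ω : Set (Euc N))) :
    (H20laplacian Ω).range = (harmonicL2 Ω)ᗮ := by
  obtain ⟨C, hC⟩ := antilipschitzWith_H20laplacian hN hbdd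
  have hcl : IsClosed ((H20laplacian Ω).range : Set (L2 Ω)) := by
    rw [LinearMap.coe_range]
    exact hC.isClosed_range (H20laplacian Ω).uniformContinuous
  rw [← orthogonal_range_H20laplacian, Submodule.orthogonal_orthogonal_eq_closure,
    hcl.submodule_topologicalClosure_eq]

/-- A continuous linear map that is bounded below on a complete subspace is an isomorphism of Banach
spaces from this subspace onto its image. -/
theorem exists_continuousLinearEquiv_of_antilipschitzWith {E F : Type*} [NormedAddCommGroup E]
    [NormedSpace ℝ E] [NormedAddCommGroup F] [NormedSpace ℝ F] [CompleteSpace F] {T : E →L[ℝ] F}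
    {W : Submodule ℝ E} [CompleteSpace W] {K : ℝ≥0} (hT : AntilipschitzWith K (T ∘L W.subtypeL))
    {S : Submodule ℝ F} (hS : (T ∘L W.subtypeL).range = S) :
    ∃ e : W ≃L[ℝ] S, ∀ u : W, (e u : F) = T u := by
  subst hS
  have hcl : IsClosed (range (T ∘L W.subtypeL)) :=
    hT.isClosed_range (T ∘L W.subtypeL).uniformContinuous
  have : CompleteSpace (T ∘L W.subtypeL).range := by
    have : IsClosed ((T ∘L W.subtypeL).range : Set F) := by rwa [LinearMap.coe_range]
    exact this.completeSpace_coe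
  exact ⟨ContinuousLinearEquiv.ofBijective (T ∘L W.subtypeL).rangeRestrict
    (LinearMap.ker_eq_bot.2 fun a b h => hT.injective (congrArg Subtype.val h))
    (LinearMap.range_eq_top.2 fun ⟨_, u, hu⟩ => ⟨u, Subtype.ext hu⟩), fun u => rfl⟩

theorem exists_H20laplacian_equiv (hN : 1 ≤ N) (hbdd : Bornology.IsBounded (Ω : Set (Euc N))) :
    ∃ T : H20 Ω ≃L[ℝ] (harmonicL2 Ω)ᗮ,
      ∀ u : H20 Ω, (T u : L2 Ω) = H2laplacian Ω (u : H2 Ω) := by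
  obtain ⟨C, hC⟩ := antilipschitzWith_H20laplacian hN hbdd
  exact exists_continuousLinearEquiv_of_antilipschitzWith (E := H2 Ω) (W := H20 Ω)
    (T := H2laplacian Ω) hC (range_H20laplacian hN hbdd)

/-! ### Traces of elements of `H²₀(Ω)` -/

theorem eLpNorm_two_sq_eq_lintegral {α : Type*} [MeasurableSpace α] (f : α → ℝ) (μ : Measure α) :
    eLpNorm f 2 μ ^ 2 = ∫⁻ x, ENNReal.ofReal (f x ^ 2) ∂μ := by
  have h := eLpNorm_nnreal_pow_eq_lintegral (f := f) (μ := μ) (p := 2) two_ne_zero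
  simp only [NNReal.coe_ofNat, ENNReal.rpow_ofNat] at h
  refine h.trans (lintegral_congr fun x => ?_)
  rw [← enorm_pow, Real.enorm_of_nonneg (sq_nonneg _)]

/-- A test function on `Ω`, extended by zero to a test function on the whole space. -/
def extendTest (φ : 𝓓(Ω, ℝ)) : 𝓓((⊤ : Opens (Euc N)), ℝ) where
  toFun := φ
  contDiff' := φ.contDiff
  hasCompactSupport' := φ.hasCompactSupport
  tsupport_subset' := subset_univ _

@[simp]
theorem coe_extendTest (φ : 𝓓(Ω, ℝ)) : ⇑(extendTest φ) = φ := rfl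

/-- The trace inequality in terms of `L²` seminorms. -/
theorem eLpNorm_surfaceMeasure_sq_le {C : ℝ≥0∞}
    (hC : ∀ φ : Euc N → ℝ, ContDiff ℝ 1 φ →
      ∫⁻ y, ENNReal.ofReal (φ y ^ 2) ∂(surfaceMeasure Ω) ≤
        C * ∫⁻ y in Ω, ENNReal.ofReal (φ y ^ 2 + ∑ i, pderiv i φ y ^ 2))
    {φ : Euc N → ℝ} (hφ : ContDiff ℝ (⊤ : ℕ∞) φ) :
    eLpNorm φ 2 (surfaceMeasure Ω) ^ 2 ≤
      C * (eLpNorm φ 2 (volume.restrict (Ω : Set (Euc N))) ^ 2 +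
        ∑ i, eLpNorm (pderiv i φ) 2 (volume.restrict (Ω : Set (Euc N))) ^ 2) := by
  simp only [eLpNorm_two_sq_eq_lintegral]
  refine (hC φ (hφ.of_le (by norm_cast))).trans_eq ?_
  congr 1
  have hm : ∀ i, Measurable fun x => ENNReal.ofReal (pderiv i φ x ^ 2) := fun i =>
    ((contDiff_pderiv i hφ).continuous.pow 2).measurable.ennreal_ofReal
  rw [← lintegral_finsetSum _ fun i _ => hm i, ← lintegral_add_left
    (f := fun x => ENNReal.ofReal (φ x ^ 2)) (hφ.continuous.pow 2).measurable.ennreal_ofReal]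
  refine lintegral_congr fun x => ?_
  rw [ENNReal.ofReal_add (sq_nonneg _) (Finset.sum_nonneg fun _ _ => sq_nonneg _),
    ENNReal.ofReal_sum_of_nonneg fun _ _ => sq_nonneg _]

theorem tendsto_eLpNorm_sub {α : Type*} [MeasurableSpace α] {μ : Measure α} {a b : ℕ → α → ℝ}
    {u : α → ℝ} (ha : ∀ k, AEStronglyMeasurable (a k) μ) (hb : ∀ k, AEStronglyMeasurable (b k) μ)
    (hu : AEStronglyMeasurable u μ)
    (h : Tendsto (fun k => eLpNorm (fun x => a k x - u x) 2 μ) atTop (𝓝 0))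
    (h' : Tendsto (fun k => eLpNorm (fun x => b k x - u x) 2 μ) atTop (𝓝 0)) :
    Tendsto (fun k => eLpNorm (fun x => a k x - b k x) 2 μ) atTop (𝓝 0) := by
  refine tendsto_of_tendsto_of_tendsto_of_le_of_le tendsto_const_nhds
    (by simpa using h.add h') (fun _ => zero_le) fun k => ?_
  have : (fun x => a k x - b k x) = (fun x => a k x - u x) - fun x => b k x - u x := by
    ext x
    simp
  simp only [this]
  exact eLpNorm_sub_le ((ha k).sub hu) ((hb k).sub hu) one_le_two

/-- Limits in `H¹(Ω)` of test functions in `Ω` have trace zero: by the trace inequality, on the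
boundary every approximating sequence from `𝓓(Ω̄)` is close to one that vanishes there. -/
theorem isTrace_zero (hN : 1 ≤ N) (hbdd : Bornology.IsBounded (Ω : Set (Euc N)))
    (hLip : HasLipschitzBoundary Ω) {u : L2 Ω} {p : Fin N → L2 Ω}
    (hp : ∀ i, IsWeakDeriv Ω i u (p i)) {ψ : ℕ → 𝓓(Ω, ℝ)}
    (hψ : TendstoH1 Ω (fun k => extendTest (ψ k)) u p) : IsTrace Ω u fun _ => 0 := by
  obtain ⟨C, hC, hCb⟩ := exists_trace_bound hN hbdd hLip
  refine ⟨MemLp.zero', p, hp, ⟨_, hψ⟩, fun φ hφ => ?_⟩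
  have h0 := tendsto_eLpNorm_sub (fun k => (φ k).continuous.aestronglyMeasurable)
    (fun k => (ψ k).continuous.aestronglyMeasurable) (Lp.aestronglyMeasurable u) hφ.1 hψ.1
  have h1 := fun i => tendsto_eLpNorm_sub
    (fun k => (contDiff_pderiv i (φ k).contDiff).continuous.aestronglyMeasurable)
    (fun k => (contDiff_pderiv i (ψ k).contDiff).continuous.aestronglyMeasurable)
    (Lp.aestronglyMeasurable (p i)) (hφ.2 i) (hψ.2 i)
  have hsq : Tendsto (fun k => eLpNorm (fun x => φ k x - 0) 2 (surfaceMeasure Ω) ^ 2) atTop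
      (𝓝 0) := by
    have hlim := ENNReal.Tendsto.const_mul (a := C) ((ENNReal.Tendsto.pow (n := 2) h0).add
      (tendsto_finsetSum Finset.univ fun i _ => ENNReal.Tendsto.pow (n := 2) (h1 i))) (Or.inr hC)
    simp only [ne_eq, OfNat.ofNat_ne_zero, not_false_eq_true, zero_pow, Finset.sum_const_zero,
      add_zero, mul_zero] at hlim
    refine tendsto_of_tendsto_of_tendsto_of_le_of_le tendsto_const_nhds hlim
      (fun _ => zero_le) fun k => ?_
    have hd : ContDiff ℝ (⊤ : ℕ∞) fun x => φ k x - ψ k x := (φ k).contDiff.sub (ψ k).contDiff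
    -- Test functions in `Ω` vanish on the boundary.
    have hΓ : eLpNorm (fun x => φ k x - 0) 2 (surfaceMeasure Ω) =
        eLpNorm (fun x => φ k x - ψ k x) 2 (surfaceMeasure Ω) := by
      refine eLpNorm_congr_ae ?_
      filter_upwards [ae_restrict_mem isClosed_frontier.measurableSet] with x hx
      have hψx : ψ k x = 0 := image_eq_zero_of_notMem_tsupport fun h =>
        (Ω.isOpen.frontier_eq ▸ hx).2 ((ψ k).tsupport_subset h)
      rw [hψx]
    have hpd : ∀ i, pderiv i (fun x => φ k x - ψ k x) =
        fun x => pderiv i (φ k) x - pderiv i (ψ k) x := fun i => by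
      ext x
      simp [pderiv, fderiv_fun_sub ((φ k).contDiff.differentiable (by simp) x)
        ((ψ k).contDiff.differentiable (by simp) x)]
    simp only [hΓ]
    refine (eLpNorm_surfaceMeasure_sq_le hCb hd).trans_eq ?_
    simp only [hpd]
  -- Take square roots in the convergence of the squared norms.
  have := (ENNReal.continuous_rpow_const (y := (2 : ℝ)⁻¹)).tendsto 0 |>.comp hsq
  rw [ENNReal.zero_rpow_of_pos (by norm_num)] at this
  refine this.congr fun k => ?_
  rw [Function.comp_apply, ← ENNReal.rpow_natCast, ← ENNReal.rpow_mul]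
  norm_num

/-- Elements of `H²₀(Ω)` are limits of test functions together with all derivatives. -/
theorem exists_seq_testToL2_tendsto {u : H2 Ω} (hu : u ∈ H20 Ω) :
    ∃ φ : ℕ → 𝓓(Ω, ℝ),
      Tendsto (fun k => testToL2 (φ k)) atTop (𝓝 (H2val u)) ∧
      (∀ i, Tendsto (fun k => testToL2 (pderivTest i (φ k))) atTop (𝓝 (H2deriv u i))) ∧
      ∀ i j, Tendsto (fun k => testToL2 (pderivTest j (pderivTest i (φ k)))) atTop
        (𝓝 (u.1 (.inr (.inr (i, j))))) := by
  obtain ⟨w, hw, hwu⟩ := mem_closure_iff_seq_limit.1 hu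
  choose φ hφ using fun k => mem_testFunctionsH2_iff.1 (hw k)
  obtain rfl : w = fun k => testToH2 (φ k) := funext hφ
  have hc : ∀ a : Jet2 N, Tendsto (fun k => (testToH2 (φ k)).1 a) atTop (𝓝 (u.1 a)) := fun a =>
    ((by fun_prop : Continuous fun v : H2 Ω => v.1 a).tendsto u).comp hwu
  exact ⟨φ, hc _, fun i => hc (.inr (.inl i)), fun i j => hc (.inr (.inr (i, j)))⟩

theorem tendsto_eLpNorm_of_tendsto_testToL2 {φ : ℕ → 𝓓(Ω, ℝ)} {u : L2 Ω}
    (h : Tendsto (fun k => testToL2 (φ k)) atTop (𝓝 u)) :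
    Tendsto (fun k => eLpNorm (fun x => φ k x - u x) 2 (volume.restrict (Ω : Set (Euc N))))
      atTop (𝓝 0) := by
  refine ((Lp.tendsto_Lp_iff_tendsto_eLpNorm' _ _).1 h).congr fun k => eLpNorm_congr_ae ?_
  filter_upwards [coeFn_testToL2 (φ k)] with x hx
  rw [Pi.sub_apply, hx]

theorem tendstoH1_extendTest {φ : ℕ → 𝓓(Ω, ℝ)} {u : L2 Ω} {p : Fin N → L2 Ω}
    (h : Tendsto (fun k => testToL2 (φ k)) atTop (𝓝 u))
    (h' : ∀ i, Tendsto (fun k => testToL2 (pderivTest i (φ k))) atTop (𝓝 (p i))) :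
    TendstoH1 Ω (fun k => extendTest (φ k)) u p := by
  unfold TendstoH1
  simp only [coe_extendTest]
  refine ⟨tendsto_eLpNorm_of_tendsto_testToL2 h, fun i => ?_⟩
  simpa only [coe_pderivTest] using tendsto_eLpNorm_of_tendsto_testToL2 (h' i)

theorem isTrace_H2val_zero (hN : 1 ≤ N) (hbdd : Bornology.IsBounded (Ω : Set (Euc N)))
    (hLip : HasLipschitzBoundary Ω) {u : H2 Ω} (hu : u ∈ H20 Ω) :
    IsTrace Ω (H2val u) fun _ => 0 := by
  obtain ⟨φ, h, h', -⟩ := exists_seq_testToL2_tendsto hu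
  exact isTrace_zero hN hbdd hLip u.2.1 (tendstoH1_extendTest h h')

theorem isTrace_H2deriv_zero (hN : 1 ≤ N) (hbdd : Bornology.IsBounded (Ω : Set (Euc N)))
    (hLip : HasLipschitzBoundary Ω) {u : H2 Ω} (hu : u ∈ H20 Ω) (i : Fin N) :
    IsTrace Ω (H2deriv u i) fun _ => 0 := by
  obtain ⟨φ, -, h, h'⟩ := exists_seq_testToL2_tendsto hu
  exact isTrace_zero hN hbdd hLip (u.2.2 i) (tendstoH1_extendTest (h i) (h' i))

theorem isNormalDeriv_zero (hN : 1 ≤ N) (hbdd : Bornology.IsBounded (Ω : Set (Euc N)))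
    (hLip : HasLipschitzBoundary Ω) {u : H2 Ω} (hu : u ∈ H20 Ω) :
    IsNormalDeriv Ω u fun _ => 0 :=
  ⟨fun _ _ => 0, isTrace_H2deriv_zero hN hbdd hLip hu, by simp⟩

end DirichletLipschitz

end

/-! ### The isomorphism and the Dirichlet problem -/

open DirichletLipschitz in
theorem mainTheorem8 {N : ℕ} (hN : 2 ≤ N) (Ω : Opens (Euc N))
    (hbdd : Bornology.IsBounded (Ω : Set (Euc N))) (hLip : HasLipschitzBoundary Ω) :
    (∃ T : H20 Ω ≃L[ℝ] (harmonicL2 Ω)ᗮ,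
      ∀ u : H20 Ω, (T u : L2 Ω) = H2laplacian Ω (u : H2 Ω)) ∧
    ∀ f : L2 Ω, (∀ φ ∈ harmonicL2 Ω, ∫ x in Ω, f x * φ x = 0) →
      ∃ u ∈ H20 Ω, H2laplacian Ω u = f ∧
        (∀ v ∈ H20 Ω, H2laplacian Ω v = f → v = u) ∧
        IsTrace Ω (H2val u) (fun _ => 0) ∧ IsNormalDeriv Ω u (fun _ => 0) := by
  have hN' : 1 ≤ N := one_le_two.trans hN
  obtain ⟨T, hT⟩ := exists_H20laplacian_equiv hN' hbdd
  refine ⟨⟨T, hT⟩, fun f hf => ?_⟩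
  have hf' : f ∈ (harmonicL2 Ω)ᗮ := (Submodule.mem_orthogonal _ _).2 fun φ hφ => by
    rw [inner_eq_setIntegral_mul]
    exact hf φ hφ
  obtain ⟨u, hu⟩ := T.surjective ⟨f, hf'⟩
  refine ⟨u, u.2, by rw [← hT, hu], fun v hv hvf => ?_, isTrace_H2val_zero hN' hbdd hLip u.2,
    isNormalDeriv_zero hN' hbdd hLip u.2⟩
  have : T ⟨v, hv⟩ = T u := Subtype.ext (by rw [hT, hu]; exact hvf)
  exact congrArg Subtype.val (T.injective this)
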